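/- Let $p$ be a prime, let $P$ be a finite $p$-group, and let $\mathcal F$ be a saturated fusion system on $P$. If $Q$ and $R$ are strongly $\mathcal F$-closed subgroups of $P$, then the product $QR=\{qr : q\in Q,\ r\in R\}$ is a subgroup of $P$, and it is strongly $\mathcal F$-closed. Here maps are written on the right and $x^g=g^{-1}xg$. A fusion system $\mathcal F$ on $P$ consists of sets $\mathrm{Hom}_{\mathcal F}(Q,R)$ of injective homomorphisms $Q\to R$, for all subgroups $Q,R\le P$, closed under composition, such that: (i) if $g\in P$ and $Q^g\le R$, then the conjugation map $Q\to R$, $x\mapsto x^g$, lies in $\mathrm{Hom}_{\mathcal F}(Q,R)$; (ii) for each $\phi\in\mathrm{Hom}_{\mathcal F}(Q,R)$ the isomorphism $Q\to Q\phi$ lies in $\mathrm{Hom}_{\mathcal F}(Q,Q\phi)$; (iii) the inverse of every isomorphism in $\mathcal F$ lies in $\mathcal F$. A subgroup $Q$ is fully normalized if $|N_P(Q)|\ge|N_P(R)|$ for every $R\le P$ such that there is an isomorphism $Q\to R$ in $\mathcal F$. The fusion system $\mathcal F$ is saturated if $\mathrm{Aut}_P(P)$ (the group of inner automorphisms of $P$)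 is a Sylow $p$-subgroup of $\mathrm{Aut}_{\mathcal F}(P)=\mathrm{Hom}_{\mathcal F}(P,P)$, and every $\phi\in\mathrm{Hom}_{\mathcal F}(Q,P)$ with $Q\phi$ fully normalized extends to a morphism in $\mathrm{Hom}_{\mathcal F}(N_\phi,P)$, where \[N_\phi=\{x\in N_P(Q) : \text{there is } y\in N_P(Q\phi) \text{ with } (g^x)\phi=(g\phi)^y \text{ for all } g\in Q\}.\] A subgroup $Q\le P$ is strongly $\mathcal F$-closed if every morphism in $\mathcal F$ whose domain is a subgroup of $Q$ has its image contained in $Q$. -/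

import Mathlib

open scoped Pointwise

universe u

/-- The homomorphism `θ_g : Q → R`, `x ↦ x ^ g = g⁻¹ x g`, for subgroups `Q`, `R` with
`Q ^ g ≤ R`. -/
def conjHom {P : Type u} [Group P] (g : P) (Q R : Subgroup P)
    (h : ∀ x ∈ Q, g⁻¹ * x * g ∈ R) : Q →* R where
  toFun x := ⟨g⁻¹ * x * g, h x x.2⟩
  map_one' := by ext; simp
  map_mul' x y := by ext; simp [mul_assoc]

/-- The image `Qφ` of a homomorphism `φ : Q → R` between subgroups of `P`, as a subgroup
of `P`. -/
def homImage {P : Type u} [Group P] {Q R : Subgroup P} (φ : Q →* R) : Subgroup P :=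
  (R.subtype.comp φ).range

/-- The homomorphism `Q → Qφ` obtained from `φ : Q → R` by restricting the codomain. -/
def homToImage {P : Type u} [Group P] {Q R : Subgroup P} (φ : Q →* R) : Q →* homImage φ :=
  (R.subtype.comp φ).rangeRestrict

/-- A fusion system on the group `P` (which is a finite `p`-group whenever this is used): for
each pair of subgroups `Q`, `R` of `P` a set of injective homomorphisms `Q → R`, closed under
composition and containing all conjugation maps induced by elements of `P`, the isomorphism
`Q → Qφ` for each of its morphisms `φ`, and the inverses of its isomorphisms. -/
structure FusionSystem (P : Type u) [Group P] where
  Hom : ∀ Q R : Subgroup P, Set (Q →* R)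
  injective : ∀ {Q R : Subgroup P} {φ : Q →* R}, φ ∈ Hom Q R → Function.Injective φ
  comp_mem : ∀ {Q R S : Subgroup P} {φ : Q →* R} {ψ : R →* S},
    φ ∈ Hom Q R → ψ ∈ Hom R S → ψ.comp φ ∈ Hom Q S
  conj_mem : ∀ (g : P) (Q R : Subgroup P) (h : ∀ x ∈ Q, g⁻¹ * x * g ∈ R),
    conjHom g Q R h ∈ Hom Q R
  toImage_mem : ∀ {Q R : Subgroup P} {φ : Q →* R},
    φ ∈ Hom Q R → homToImage φ ∈ Hom Q (homImage φ)
  symm_mem : ∀ {Q R : Subgroup P} (e : Q ≃* R),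
    e.toMonoidHom ∈ Hom Q R → e.symm.toMonoidHom ∈ Hom R Q

namespace FusionSystem

/-- `Aut_P(Q)`: the group of automorphisms of `Q` induced by conjugation with elements of
`N_P(Q)`. -/
def autInner {P : Type u} [Group P] (Q : Subgroup P) : Subgroup (MulAut Q) :=
  Q.normalizerMonoidHom.range

/-- `Aut_F(Q)`: the group of automorphisms of `Q` lying in `F`. -/
def aut {P : Type u} [Group P] (F : FusionSystem P) (Q : Subgroup P) : Subgroup (MulAut Q) where
  carrier := {e | MulEquiv.toMonoidHom e ∈ F.Hom Q Q}
  one_mem' := by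
    have h := F.conj_mem 1 Q Q (by simp)
    have e : conjHom 1 Q Q (by simp) = MulEquiv.toMonoidHom (1 : MulAut Q) := by
      ext x; simp [conjHom]
    rwa [e] at h
  mul_mem' := by
    intro a b ha hb
    exact F.comp_mem hb ha
  inv_mem' := by
    intro a ha
    exact F.symm_mem a ha

/-- `Q` is fully normalized: `|N_P(Q)| ≥ |N_P(R)|` for every `R` that is `F`-isomorphic
to `Q`. -/
def FullyNormalized {P : Type u} [Group P] (F : FusionSystem P) (Q : Subgroup P) : Prop :=
  ∀ (R : Subgroup P) (e : Q ≃* R), e.toMonoidHom ∈ F.Hom Q R →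
    Nat.card (Subgroup.normalizer (R : Set P)) ≤ Nat.card (Subgroup.normalizer (Q : Set P))

/-- The subgroup `N_φ` of those `x ∈ N_P(Q)` for which there is `y ∈ N_P(Qφ)` with
`(g ^ x)φ = (gφ) ^ y` for all `g ∈ Q`. Here `g'` stands for `g ^ x`, which lies in `Q`
because `x` normalizes `Q`. -/
def extender {P : Type u} [Group P] {Q R : Subgroup P} (φ : Q →* R) : Subgroup P where
  carrier := {x | x ∈ Subgroup.normalizer (Q : Set P) ∧
    ∃ y ∈ Subgroup.normalizer (homImage φ : Set P),
      ∀ g g' : Q, (g' : P) = x⁻¹ * g * x → (φ g' : P) = y⁻¹ * φ g * y}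
  one_mem' := by
    refine ⟨one_mem _, 1, one_mem _, ?_⟩
    intro g g' h
    have : g' = g := by ext; simpa using h
    simp [this]
  mul_mem' := by
    rintro a b ⟨ha, y, hy, h⟩ ⟨hb, z, hz, k⟩
    refine ⟨mul_mem ha hb, y * z, mul_mem hy hz, ?_⟩
    intro g g' e
    have hm : a⁻¹ * g * a ∈ Q := by
      have := (Subgroup.mem_normalizer_iff.1 (inv_mem ha) (g : P)).1 g.2
      simpa using this
    have h1 := h g ⟨_, hm⟩ rfl
    have h2 := k ⟨_, hm⟩ g' (by rw [e]; group)
    rw [h2, h1]; group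
  inv_mem' := by
    rintro a ⟨ha, y, hy, h⟩
    refine ⟨inv_mem ha, y⁻¹, inv_mem hy, ?_⟩
    intro g g' e
    rw [h g' g (by rw [e]; group)]; group

/-- `Q ≤ N_φ`, so that it makes sense to extend `φ` to `N_φ`. -/
theorem le_extender {P : Type u} [Group P] {Q R : Subgroup P} (φ : Q →* R) :
    Q ≤ extender φ := by
  intro x hx
  refine ⟨Subgroup.le_normalizer hx, φ ⟨x, hx⟩, Subgroup.le_normalizer ⟨⟨x, hx⟩, rfl⟩, ?_⟩
  intro g g' e
  have : g' = (⟨x, hx⟩ : Q)⁻¹ * g * ⟨x, hx⟩ := by ext; simpa using e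
  rw [this]; simp

/-- `F` is saturated: `Aut_P(P)` is a Sylow `p`-subgroup of `Aut_F(P)`, and each morphism
`φ : Q → P` in `F` with `Qφ` fully normalized extends to a morphism `N_φ → P` in `F`. -/
structure IsSaturated (p : ℕ) {P : Type u} [Group P] (F : FusionSystem P) : Prop where
  sylow : ∃ S : Sylow p (F.aut ⊤), (S : Subgroup (F.aut ⊤)) = (autInner ⊤).subgroupOf (F.aut ⊤)
  extends_to : ∀ (Q : Subgroup P) (φ : Q →* (⊤ : Subgroup P)), φ ∈ F.Hom Q ⊤ →
    F.FullyNormalized (homImage φ) →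
      ∃ ψ ∈ F.Hom (extender φ) ⊤, ψ.comp (Subgroup.inclusion (le_extender φ)) = φ

/-- `Q` is strongly `F`-closed: each morphism of `F` whose domain is a subgroup of `Q` has its
image contained in `Q`. -/
def StronglyClosed {P : Type u} [Group P] (F : FusionSystem P) (Q : Subgroup P) : Prop :=
  ∀ (R S : Subgroup P) (φ : R →* S), φ ∈ F.Hom R S → R ≤ Q → homImage φ ≤ Q

end FusionSystem

/-! Call a morphism `f` on `A` liftable modulo a strongly closed `Q` if some morphism `g` on `AQ`
agrees with `f` on `A` modulo `Q`. Since strongly closed subgroups are normal, this is a congruence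
in `P/Q`. If every morphism lifts, the theorem follows: write `a ∈ A ∩ QR` as `a = qr`. Then `r =
q⁻¹a` lies in `AQ`, so `g(a) = g(q)g(r) ∈ QR`, and `f(a) ∈ g(a)Q ⊆ QR`.

Lifting (`IsSaturated.liftsMod`) goes by induction on `|P| - |A|`. Let `E` be a fully normalized
subgroup in the class of `A`. Suitable isomorphisms from `A` and from `f(A)` to `E` extend to the
normalizers, which are larger, so they lift. Liftable maps compose and invert, which leaves an
automorphism `α` of `E`. A Frattini argument in `Aut_F(E)` changes `α` by an automorphism trivial
modulo `Q`, so that the result extends to `N_{EQ}(E)`. This is larger than `E` unless `Q ≤ E`, where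
there is nothing to prove.

The Frattini argument needs `Aut_P(E)` to be Sylow in `Aut_F(E)`. Saturation demands this only for
`E = P`; `IsSaturated.fullyAutomized` derives it for every fully normalized `E`. -/

namespace FusionSystem

/-! ### Morphisms into `P` and the extension axiom -/

variable {P : Type u} [Group P] (F : FusionSystem P)

/-- A homomorphism `f : A → P` is a morphism of `F`. -/
def Mor {A : Subgroup P} (f : A →* P) : Prop :=
  f.codRestrict (⊤ : Subgroup P) (fun _ => Subgroup.mem_top _) ∈ F.Hom A ⊤

variable {F} {A B C : Subgroup P}

theorem inclusion_mem (h : A ≤ B) : Subgroup.inclusion h ∈ F.Hom A B := by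
  have := F.conj_mem 1 A B (by simpa using fun x hx => h hx)
  convert this
  ext x
  simp [conjHom]

theorem mor_subtype_comp {φ : A →* B} (h : φ ∈ F.Hom A B) : F.Mor (B.subtype.comp φ) :=
  F.comp_mem h (inclusion_mem le_top)

theorem Mor.codRestrict_mem {f : A →* P} (h : F.Mor f) (hB : ∀ a, f a ∈ B) :
    f.codRestrict B hB ∈ F.Hom A B := by
  have h1 := F.toImage_mem h
  have hle : homImage (f.codRestrict (⊤ : Subgroup P) (fun _ => Subgroup.mem_top _)) ≤ B := by
    rintro _ ⟨a, rfl⟩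
    exact hB a
  exact F.comp_mem h1 (inclusion_mem hle)

theorem Mor.injective {f : A →* P} (h : F.Mor f) : Function.Injective f := by
  intro a b hab
  exact F.injective h (Subtype.ext hab)

theorem Mor.restrict {f : B →* P} (h : F.Mor f) (hA : A ≤ B) :
    F.Mor (f.comp (Subgroup.inclusion hA)) :=
  F.comp_mem (inclusion_mem hA) h

theorem Mor.comp {f : A →* P} {g : B →* P} (hg : F.Mor g) (hf : F.Mor f) (hB : ∀ a, f a ∈ B) :
    F.Mor (g.comp (f.codRestrict B hB)) :=
  F.comp_mem (hf.codRestrict_mem hB) hg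

/-- A morphism of `F` with image `B` comes from an isomorphism onto `B` in `F`. -/
theorem Mor.exists_mulEquiv {f : A →* P} (h : F.Mor f) (hB : f.range = B) :
    ∃ e : A ≃* B, e.toMonoidHom ∈ F.Hom A B ∧ ∀ a, (e a : P) = f a := by
  subst hB
  refine ⟨MulEquiv.ofBijective f.rangeRestrict
    ⟨fun a b hab => h.injective (congrArg Subtype.val hab), f.rangeRestrict_surjective⟩, ?_,
    fun _ => rfl⟩
  exact h.codRestrict_mem (B := f.range) (fun a => ⟨a, rfl⟩)

theorem mor_of_mulEquiv {e : A ≃* B} (h : e.toMonoidHom ∈ F.Hom A B) :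
    F.Mor (B.subtype.comp e.toMonoidHom) := mor_subtype_comp h

theorem range_subtype_comp_mulEquiv (e : A ≃* B) :
    (B.subtype.comp e.toMonoidHom).range = B := by
  ext x
  constructor
  · rintro ⟨a, rfl⟩
    exact (e a).2
  · intro hx
    exact ⟨e.symm ⟨x, hx⟩, by simp⟩

theorem mulEquiv_trans_mem {e : A ≃* B} {e' : B ≃* C} (h : e.toMonoidHom ∈ F.Hom A B)
    (h' : e'.toMonoidHom ∈ F.Hom B C) : (e.trans e').toMonoidHom ∈ F.Hom A C :=
  F.comp_mem h h'

theorem mem_aut {α : MulAut A} : α ∈ F.aut A ↔ MulEquiv.toMonoidHom α ∈ F.Hom A A := Iff.rfl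

/-- Conjugation with an isomorphism in `F` preserves automorphisms in `F`. -/
theorem congr_mem_aut {e : A ≃* B} (h : e.toMonoidHom ∈ F.Hom A B) {α : MulAut A}
    (hα : α ∈ F.aut A) : MulAut.congr e α ∈ F.aut B :=
  F.comp_mem (F.comp_mem (F.symm_mem e h) hα) h

theorem mem_autInner {α : MulAut A} :
    α ∈ autInner A ↔ ∃ y ∈ Subgroup.normalizer (A : Set P), ∀ a, (α a : P) = y * a * y⁻¹ := by
  constructor
  · rintro ⟨y, rfl⟩
    exact ⟨y, y.2, fun a => rfl⟩
  · rintro ⟨y, hy, h⟩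
    exact ⟨⟨y, hy⟩, by ext a; exact (h a).symm⟩

theorem autInner_le_aut : autInner A ≤ F.aut A := by
  rintro α hα
  obtain ⟨y, hy, h⟩ := mem_autInner.1 hα
  have := F.conj_mem y⁻¹ A A (fun x hx => by
    simpa using (Subgroup.mem_normalizer_iff.1 hy x).1 hx)
  rw [mem_aut]
  convert this
  ext a
  simp [conjHom, h]

theorem isPGroup_autInner {p : ℕ} (hP : IsPGroup p P) : IsPGroup p (autInner A) :=
  (hP.to_subgroup _).of_surjective _ (MonoidHom.rangeRestrict_surjective _)

theorem FullyNormalized.card_normalizer_le {E : Subgroup P} (hE : F.FullyNormalized E)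
    {f : E →* P} (hf : F.Mor f) : Nat.card (Subgroup.normalizer (f.range : Set P)) ≤
      Nat.card (Subgroup.normalizer (E : Set P)) := by
  obtain ⟨e, he, -⟩ := hf.exists_mulEquiv rfl
  exact hE _ e he

theorem exists_fullyNormalized [Finite P] (F : FusionSystem P) (A : Subgroup P) :
    ∃ (E : Subgroup P) (e : A ≃* E), e.toMonoidHom ∈ F.Hom A E ∧ F.FullyNormalized E := by
  let S : Set (Subgroup P) := {E | ∃ e : A ≃* E, e.toMonoidHom ∈ F.Hom A E}
  have hS : S.Nonempty := ⟨A, MulEquiv.refl A, (F.aut A).one_mem⟩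
  obtain ⟨E, ⟨e, he⟩, hmax⟩ := S.toFinite.exists_maximalFor
    (fun E : Subgroup P => Nat.card (Subgroup.normalizer (E : Set P))) S hS
  refine ⟨E, e, he, fun R e' he' => ?_⟩
  exact le_of_not_gt fun hlt => absurd
    (hmax (j := R) ⟨e.trans e', mulEquiv_trans_mem he he'⟩ hlt.le) (not_le.2 hlt)

/-- The extension axiom, for a subgroup of `N_φ`. -/
theorem IsSaturated.exists_extension {p : ℕ} (hF : F.IsSaturated p) {N : Subgroup P} {e : A ≃* B}
    (he : e.toMonoidHom ∈ F.Hom A B) (hB : F.FullyNormalized B) (hAN : A ≤ N)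
    (hN : ∀ x ∈ N, x ∈ Subgroup.normalizer (A : Set P) ∧
      ∃ y ∈ Subgroup.normalizer (B : Set P), ∀ a a' : A, (a' : P) = x * a * x⁻¹ →
        (e a' : P) = y * e a * y⁻¹) :
    ∃ ψ : N →* P, F.Mor ψ ∧ ∀ a : A, ψ ⟨a, hAN a.2⟩ = e a := by
  set φ := (B.subtype.comp e.toMonoidHom).codRestrict (⊤ : Subgroup P)
    (fun _ => Subgroup.mem_top _) with hφ
  have him : homImage φ = B := range_subtype_comp_mulEquiv e
  have hle : N ≤ extender φ := by
    intro x hx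
    obtain ⟨hx1, -⟩ := hN x hx
    obtain ⟨-, y, hy, h⟩ := hN x⁻¹ (inv_mem hx)
    refine ⟨hx1, y⁻¹, by rw [him]; exact inv_mem hy, fun g g' hg => ?_⟩
    rw [inv_inv]
    exact h g g' (by simpa using hg)
  obtain ⟨ψ, hψ, hext⟩ := hF.extends_to A φ (mor_of_mulEquiv he) (by rw [him]; exact hB)
  refine ⟨(Subgroup.subtype ⊤).comp (ψ.comp (Subgroup.inclusion hle)), ?_, fun a => ?_⟩
  · exact mor_subtype_comp (F.comp_mem (inclusion_mem hle) hψ)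
  · exact congrArg Subtype.val (DFunLike.congr_fun hext a)

end FusionSystem

/-! ### Sylow theory in finite groups -/

section SylowTheory

variable {G : Type*} [Group G] [Finite G] {p : ℕ} [Fact p.Prime]

/-- A `p`-subgroup `H` that is not Sylow is normalized by some `p`-element outside `H`. -/
theorem exists_mem_normalizer_of_not_sylow {H : Subgroup G} (hH : IsPGroup p H)
    (h : ¬ ∃ S : Sylow p G, (S : Subgroup G) = H) :
    ∃ g ∈ Subgroup.normalizer (H : Set G), g ∉ H ∧ ∃ a, g ^ p ^ a = 1 := by
  obtain ⟨S, hS⟩ := hH.exists_le_sylow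
  have : Group.IsNilpotent S := S.isPGroup'.isNilpotent
  have hlt : H.subgroupOf S < ⊤ := by
    rw [lt_top_iff_ne_top, Ne, Subgroup.subgroupOf_eq_top]
    exact fun hle => h ⟨S, le_antisymm hle hS⟩
  obtain ⟨g, hg, hgH⟩ := SetLike.exists_of_lt
    (Group.normalizerCondition_of_isNilpotent (G := S) _ hlt)
  refine ⟨g, ?_, hgH, ?_⟩
  · refine Subgroup.mem_normalizer_fintype fun x hx => ?_
    exact (Subgroup.mem_normalizer_iff.1 hg ⟨x, hS hx⟩).1 hx
  · obtain ⟨a, ha⟩ := S.isPGroup' g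
    exact ⟨a, by simpa using congrArg Subtype.val ha⟩

/-- Some power of `g` is a `p`-element, with the exponent congruent to `1` modulo a given power
of `p`. -/
theorem exists_pow_pow_eq_one (g : G) (a : ℕ) :
    ∃ m b : ℕ, m ≡ 1 [MOD p ^ a] ∧ (g ^ m) ^ p ^ b = 1 := by
  have hp : p.Prime := Fact.out
  obtain ⟨b, t, ht, hbt⟩ := Nat.exists_eq_pow_mul_and_not_dvd (orderOf_pos g).ne' p hp.ne_one
  have hcop : (p ^ a).Coprime t := Nat.Coprime.pow_left _ ((hp.coprime_iff_not_dvd).2 ht)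
  -- Here `t` is the part of the order of `g` prime to `p`; `m ≡ 0` modulo `t` makes `g ^ m` a
  -- `p`-element.
  obtain ⟨m, hm1, hm2⟩ := Nat.chineseRemainder hcop 1 0
  refine ⟨m, b, hm1, ?_⟩
  rw [← pow_mul, ← orderOf_dvd_iff_pow_eq_one, hbt, mul_comm]
  exact mul_dvd_mul ((Nat.modEq_zero_iff_dvd).1 hm2) dvd_rfl

/-- Every `p`-subgroup is conjugate into a given Sylow `p`-subgroup. -/
theorem Sylow.exists_conj_mem (S : Sylow p G) {H : Subgroup G} (hH : IsPGroup p H) :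
    ∃ g : G, ∀ h ∈ H, g * h * g⁻¹ ∈ S := by
  obtain ⟨T, hT⟩ := hH.exists_le_sylow
  obtain ⟨g, rfl⟩ := MulAction.exists_smul_eq G T S
  refine ⟨g, fun h hh => ?_⟩
  exact Subgroup.smul_mem_pointwise_smul h (MulAut.conj g) (T : Subgroup G) (hT hh)

/-- A form of the Frattini argument. -/
theorem Sylow.exists_mul_conj_mem (S : Sylow p G) (K : Subgroup G) [hK : K.Normal] (g : G) :
    ∃ k ∈ K, ∀ x ∈ S, x ∈ K → (k * g) * x * (k * g)⁻¹ ∈ S := by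
  -- Inside `KS` some `sk` conjugates the `p`-group `g(S ∩ K)g⁻¹ ≤ K` into `S`; the factor `s ∈ S`
  -- can then be dropped.
  let M : Subgroup G := K ⊔ S
  let H : Subgroup G := ((S : Subgroup G) ⊓ K).map (MulAut.conj g).toMonoidHom
  have hH : IsPGroup p (H.subgroupOf M) :=
    ((S.isPGroup'.to_le inf_le_left).map _).comap_of_injective M.subtype M.subtype_injective
  obtain ⟨⟨m, hm⟩, hmS⟩ := (S.subtype (N := M) le_sup_right).exists_conj_mem hH
  have hm' : m ∈ (S : Subgroup G) ⊔ K := by rwa [sup_comm]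
  obtain ⟨s, hs, k, hk, rfl⟩ := Subgroup.mem_sup_of_normal_right.1 hm'
  refine ⟨k, hk, fun x hx hxK => ?_⟩
  have hxH : g * x * g⁻¹ ∈ H := ⟨x, ⟨hx, hxK⟩, by simp⟩
  have hxM : g * x * g⁻¹ ∈ M := (le_sup_left : K ≤ M) (hK.conj_mem x hxK g)
  have h1 : (s * k) * (g * x * g⁻¹) * (s * k)⁻¹ ∈ (S : Subgroup G) := hmS ⟨_, hxM⟩ hxH
  have h2 := mul_mem (mul_mem (inv_mem hs) h1) hs
  change _ ∈ (S : Subgroup G)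
  convert h2 using 1
  group

end SylowTheory

/-! ### Fully normalized subgroups are fully automized -/

namespace FusionSystem

variable {P : Type u} [Group P] {F : FusionSystem P} {A B : Subgroup P} {p : ℕ}

/-- `Aut_P(E)` is a Sylow `p`-subgroup of `Aut_F(E)`. -/
def FullyAutomized (p : ℕ) (F : FusionSystem P) (E : Subgroup P) : Prop :=
  ∃ S : Sylow p (F.aut E), (S : Subgroup (F.aut E)) = (autInner E).subgroupOf (F.aut E)

theorem FullyAutomized.exists_conj_mem [Finite P] [Fact p.Prime] {E : Subgroup P}
    (hE : F.FullyAutomized p E) {H : Subgroup (MulAut E)} (hH : IsPGroup p H)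
    (hle : H ≤ F.aut E) : ∃ χ ∈ F.aut E, ∀ h ∈ H, χ * h * χ⁻¹ ∈ autInner E := by
  obtain ⟨S, hS⟩ := hE
  have : Finite (MulAut E) := Finite.of_injective (fun e : MulAut E => (e : E → E))
    DFunLike.coe_injective
  obtain ⟨⟨χ, hχ⟩, h⟩ := S.exists_conj_mem (H := H.subgroupOf (F.aut E))
    (hH.comap_of_injective _ (Subgroup.subtype_injective _))
  refine ⟨χ, hχ, fun x hx => ?_⟩
  have := h ⟨x, hle hx⟩ hx
  rw [← SetLike.mem_coe, ← Sylow.coe_coe, hS] at this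
  exact this

/-- Given a `p`-group `H` of automorphisms of `A` in `F`, some isomorphism from `A` to `B` in `F`
conjugates `H` into `Aut_P(B)`. -/
theorem FullyAutomized.exists_mulEquiv [Finite P] [Fact p.Prime]
    (hB : F.FullyAutomized p B) {e : A ≃* B} (he : e.toMonoidHom ∈ F.Hom A B)
    {H : Subgroup (MulAut A)} (hH : IsPGroup p H) (hle : H ≤ F.aut A) :
    ∃ e' : A ≃* B, e'.toMonoidHom ∈ F.Hom A B ∧ ∀ h ∈ H,
      ∃ y ∈ Subgroup.normalizer (B : Set P), ∀ a, (e' (h a) : P) = y * e' a * y⁻¹ := by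
  obtain ⟨χ, hχ, h⟩ := hB.exists_conj_mem (hH.map (MulAut.congr e).toMonoidHom)
    (by rintro _ ⟨α, hα, rfl⟩; exact congr_mem_aut he (hle hα))
  refine ⟨e.trans χ, mulEquiv_trans_mem he hχ, fun α hα => ?_⟩
  obtain ⟨y, hy, hyx⟩ := mem_autInner.1 (h _ ⟨α, hα, rfl⟩)
  refine ⟨y, hy, fun a => ?_⟩
  have := hyx (χ (e a))
  simpa [MulAut.congr] using this

theorem card_lt_card_normalizer [Finite P] [Fact p.Prime] (hP : IsPGroup p P)
    (hA : A ≠ ⊤) : Nat.card A < Nat.card (Subgroup.normalizer (A : Set P)) := by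
  have : Group.IsNilpotent P := hP.isNilpotent
  exact Set.Finite.card_lt_card (Set.toFinite _)
    (Group.normalizerCondition_of_isNilpotent (G := P) _ (lt_top_iff_ne_top.2 hA))

/-- If `E` is fully normalized, then an automorphism of `E` normalizing `Aut_P(E)` is induced by
an automorphism of `N_P(E)`. -/
theorem IsSaturated.exists_aut_normalizer [Finite P] (hF : F.IsSaturated p) {E : Subgroup P}
    (hE : F.FullyNormalized E) {φ : MulAut E} (hφ : φ ∈ F.aut E)
    (hn : ∀ α ∈ autInner E, φ * α * φ⁻¹ ∈ autInner E) :
    ∃ ψ ∈ F.aut (Subgroup.normalizer (E : Set P)),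
      ∀ a : E, (ψ ⟨a, Subgroup.le_normalizer a.2⟩ : P) = φ a := by
  obtain ⟨g, hg, hgφ⟩ := hF.exists_extension (N := Subgroup.normalizer (E : Set P)) hφ hE
    Subgroup.le_normalizer (by
      intro x hx
      refine ⟨hx, ?_⟩
      obtain ⟨y, hy, hyx⟩ := mem_autInner.1 (hn _ ⟨⟨x, hx⟩, rfl⟩)
      refine ⟨y, hy, fun a a' haa => ?_⟩
      have h1 := hyx (φ a)
      have h2 : E.normalizerMonoidHom ⟨x, hx⟩ a = a' := Subtype.ext haa.symm
      simpa [h2] using h1)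
  have hmem : ∀ n, g n ∈ Subgroup.normalizer (E : Set P) := by
    intro n
    refine Subgroup.mem_normalizer_fintype fun x hx => ?_
    obtain ⟨a, ha⟩ := φ.surjective ⟨x, hx⟩
    have ha' : x = g ⟨a, Subgroup.le_normalizer a.2⟩ := by rw [hgφ, ha]
    have hna : (n : P) * a * (n : P)⁻¹ ∈ E := (Subgroup.mem_normalizer_iff.1 n.2 a).1 a.2
    have h1 := hgφ ⟨_, hna⟩
    have h2 : (⟨(n : P) * a * (n : P)⁻¹, Subgroup.le_normalizer hna⟩ :
      Subgroup.normalizer (E : Set P)) = n * ⟨a, Subgroup.le_normalizer a.2⟩ * n⁻¹ := rfl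
    rw [h2, map_mul, map_mul, map_inv, ← ha'] at h1
    rw [h1]
    exact (φ _).2
  have hrange : g.range = Subgroup.normalizer (E : Set P) := by
    refine Subgroup.eq_of_le_of_card_ge (by rintro _ ⟨n, rfl⟩; exact hmem n) ?_
    exact (Nat.card_congr (MonoidHom.ofInjective hg.injective).toEquiv).le
  obtain ⟨e, he, heg⟩ := hg.exists_mulEquiv hrange
  exact ⟨e, he, fun a => by rw [heg, hgφ]⟩

/-- Otherwise some `p`-element `φ` outside `Aut_P(E)` normalizes it and extends to an automorphism
of `N = N_P(E)`. By induction the class of `N` contains a fully automized `N'`, where a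
`p`-power-order extension of `φ` becomes conjugation by some `y ∈ P`. Maximality of `|N_P(E)|`
forces `y ∈ N'`, so `φ` is induced by an element of `N` after all. -/
theorem IsSaturated.fullyAutomized [Finite P] [Fact p.Prime] (hP : IsPGroup p P)
    (hF : F.IsSaturated p) {E : Subgroup P} (hE : F.FullyNormalized E) :
    F.FullyAutomized p E := by
  induction hn : Nat.card P - Nat.card E using Nat.strong_induction_on generalizing E with
  | _ n ih =>
  subst hn
  by_cases htop : E = ⊤
  · subst htop
    exact hF.sylow
  have hlt := card_lt_card_normalizer hP htop
  have : Finite (MulAut E) := Finite.of_injective (fun e : MulAut E => (e : E → E))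
    DFunLike.coe_injective
  by_contra hcon
  obtain ⟨⟨φ, hφ⟩, hφn, hφi, a, ha⟩ := exists_mem_normalizer_of_not_sylow
    (H := (autInner E).subgroupOf (F.aut E))
    ((isPGroup_autInner hP).comap_of_injective _ (Subgroup.subtype_injective _)) hcon
  apply hφi
  rw [Subgroup.mem_subgroupOf]
  set N := Subgroup.normalizer (E : Set P) with hN
  obtain ⟨ψ, hψ, hψφ⟩ := hF.exists_aut_normalizer hE hφ (fun α hα =>
    (Subgroup.mem_normalizer_iff.1 hφn ⟨α, autInner_le_aut hα⟩).1 hα)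
  have : Finite (MulAut N) := Finite.of_injective (fun e : MulAut N => (e : N → N))
    DFunLike.coe_injective
  -- As `φ ^ p ^ a = 1` and `m ≡ 1` modulo `p ^ a`, the `p`-element `ψ ^ m` still restricts to `φ`.
  obtain ⟨m, b, hm, hb⟩ := exists_pow_pow_eq_one (p := p) ψ a
  have hpow : ∀ k : ℕ, ∀ x : E, ((ψ ^ k) ⟨x, Subgroup.le_normalizer x.2⟩ : P) = (φ ^ k) x := by
    intro k
    induction k with
    | zero => intro x; rfl
    | succ k ihk =>
      intro x
      rw [pow_succ, pow_succ, MulAut.mul_apply, MulAut.mul_apply, ← ihk]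
      congr 2
      exact Subtype.ext (hψφ x)
  have hφm : φ ^ m = φ := by
    have h1 : φ ^ p ^ a = 1 := congrArg Subtype.val ha
    have h2 := pow_eq_pow_iff_modEq.2 (hm.of_dvd (orderOf_dvd_of_pow_eq_one h1))
    rwa [pow_one] at h2
  obtain ⟨N', e, he, hN'⟩ := exists_fullyNormalized F N
  have hcard : Nat.card N' = Nat.card N := (Nat.card_congr e.toEquiv).symm
  have hle : Nat.card N ≤ Nat.card P := Subgroup.card_le_card_group N
  have hN'a : F.FullyAutomized p N' := ih _ (by omega) hN' rfl
  obtain ⟨τ, hτ, hconj⟩ := hN'a.exists_mulEquiv he (H := Subgroup.zpowers (ψ ^ m))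
    (by
      rintro ⟨_, k, rfl⟩
      refine ⟨b, Subtype.ext ?_⟩
      change ((ψ ^ m) ^ k) ^ p ^ b = 1
      rw [← zpow_natCast, ← zpow_mul, mul_comm, zpow_mul, zpow_natCast, hb, one_zpow])
    (by rw [Subgroup.zpowers_le]; exact pow_mem hψ m)
  obtain ⟨y, hy, hyτ⟩ := hconj _ (Subgroup.mem_zpowers _)
  have hEN : E ≤ N := Subgroup.le_normalizer
  set f : E →* P := (N'.subtype.comp τ.toMonoidHom).comp (Subgroup.inclusion hEN) with hf
  have hfm : F.Mor f := (mor_of_mulEquiv hτ).restrict hEN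
  have hy' : y ∈ Subgroup.normalizer (f.range : Set P) := by
    refine Subgroup.mem_normalizer_fintype ?_
    rintro _ ⟨x, rfl⟩
    refine ⟨φ x, ?_⟩
    have h1 := hyτ ⟨x, hEN x.2⟩
    have h2 : (ψ ^ m) ⟨x, hEN x.2⟩ = ⟨φ x, hEN (φ x).2⟩ := by
      refine Subtype.ext ?_
      rw [hpow, hφm]
    rw [h2] at h1
    exact h1
  have hle' : N' ≤ Subgroup.normalizer (f.range : Set P) := by
    intro z hz
    obtain ⟨n, hn⟩ := τ.surjective ⟨z, hz⟩
    refine Subgroup.mem_normalizer_fintype ?_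
    rintro _ ⟨x, rfl⟩
    have hnx : (n : P) * x * (n : P)⁻¹ ∈ E := (Subgroup.mem_normalizer_iff.1 n.2 x).1 x.2
    refine ⟨⟨_, hnx⟩, ?_⟩
    have h2 : (⟨(n : P) * x * (n : P)⁻¹, hEN hnx⟩ : N) = n * ⟨x, hEN x.2⟩ * n⁻¹ := rfl
    change (τ ⟨(n : P) * x * (n : P)⁻¹, hEN hnx⟩ : P) = z * τ ⟨x, hEN x.2⟩ * z⁻¹
    rw [h2, map_mul, map_mul, map_inv, hn]
    rfl
  -- `|N_P(τ(E))| ≤ |N_P(E)| = |N'|` because `E` is fully normalized.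
  have heq : N' = Subgroup.normalizer (f.range : Set P) :=
    Subgroup.eq_of_le_of_card_ge hle' (hcard ▸ hE.card_normalizer_le hfm)
  obtain ⟨n, hn⟩ := τ.surjective ⟨y, heq ▸ hy'⟩
  refine mem_autInner.2 ⟨n, n.2, fun x => ?_⟩
  have h1 := hyτ ⟨x, hEN x.2⟩
  have h2 : τ ((ψ ^ m) ⟨x, hEN x.2⟩) = τ (n * ⟨x, hEN x.2⟩ * n⁻¹) := by
    refine Subtype.ext ?_
    rw [h1, map_mul, map_mul, map_inv, hn]
    rfl
  have h3 := congrArg Subtype.val (τ.injective h2)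
  rw [hpow, hφm] at h3
  exact h3

/-- A subgroup is isomorphic in `F` to a given fully normalized subgroup of its class by an
isomorphism that extends to the normalizer. -/
theorem IsSaturated.exists_extension_normalizer [Finite P] [Fact p.Prime] (hP : IsPGroup p P)
    (hF : F.IsSaturated p) {e : A ≃* B} (he : e.toMonoidHom ∈ F.Hom A B)
    (hB : F.FullyNormalized B) :
    ∃ (e' : A ≃* B) (ψ : Subgroup.normalizer (A : Set P) →* P), e'.toMonoidHom ∈ F.Hom A B ∧
      F.Mor ψ ∧ ∀ a : A, ψ ⟨a, Subgroup.le_normalizer a.2⟩ = e' a := by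
  obtain ⟨e', he', h⟩ := (hF.fullyAutomized hP hB).exists_mulEquiv he (isPGroup_autInner hP)
    autInner_le_aut
  obtain ⟨ψ, hψ, hψe⟩ := hF.exists_extension (N := Subgroup.normalizer (A : Set P)) he' hB
    Subgroup.le_normalizer (by
      intro x hx
      obtain ⟨y, hy, hyx⟩ := h _ ⟨⟨x, hx⟩, rfl⟩
      refine ⟨hx, y, hy, fun a a' haa => ?_⟩
      rw [← hyx]
      exact congrArg (fun z => (e' z : P)) (Subtype.ext haa))
  exact ⟨e', ψ, he', hψ, hψe⟩

end FusionSystem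
-- Lifting morphisms modulo a strongly closed subgroup
namespace FusionSystem

variable {P : Type u} [Group P] {F : FusionSystem P} {A B Q : Subgroup P} {p : ℕ}

theorem stronglyClosed_iff :
    F.StronglyClosed Q ↔ ∀ {A : Subgroup P} (f : A →* P), F.Mor f → ∀ a : A, (a : P) ∈ Q →
      f a ∈ Q := by
  constructor
  · intro h A f hf a ha
    exact h _ _ _ (hf.restrict (inf_le_left : A ⊓ Q ≤ A)) inf_le_right ⟨⟨a, a.2, ha⟩, rfl⟩
  · rintro h A B φ hφ hA _ ⟨a, rfl⟩
    exact h _ (mor_subtype_comp hφ) a (hA a.2)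

theorem StronglyClosed.apply_mem (hQ : F.StronglyClosed Q) {f : A →* P} (hf : F.Mor f) {a : A}
    (ha : (a : P) ∈ Q) : f a ∈ Q :=
  stronglyClosed_iff.1 hQ f hf a ha

theorem StronglyClosed.normal (hQ : F.StronglyClosed Q) : Q.Normal := by
  refine ⟨fun x hx g => ?_⟩
  have := hQ.apply_mem (mor_subtype_comp (F.conj_mem g⁻¹ Q ⊤ (fun _ _ => Subgroup.mem_top _)))
    (a := ⟨x, hx⟩) hx
  simpa [conjHom] using this

/-- The map `f : A → P` is congruent modulo `Q` to the restriction of a morphism of `F` on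
`A ⊔ Q`. -/
def LiftsMod (F : FusionSystem P) (Q : Subgroup P) {A : Subgroup P} (f : A →* P) : Prop :=
  ∃ g : (A ⊔ Q : Subgroup P) →* P, F.Mor g ∧
    ∀ a : A, (f a)⁻¹ * g ⟨a, (le_sup_left : A ≤ A ⊔ Q) a.2⟩ ∈ Q

theorem liftsMod_of_le {f : A →* P} (hf : F.Mor f) (h : Q ≤ A) : F.LiftsMod Q f := by
  refine ⟨f.comp (Subgroup.inclusion (sup_le le_rfl h)), hf.restrict _, fun a => ?_⟩
  simp [Subgroup.inclusion]

theorem LiftsMod.restrict {f : A →* P} {g : B →* P} (hg : F.LiftsMod Q g) (hAB : A ≤ B)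
    (h : ∀ a : A, (f a)⁻¹ * g ⟨a, hAB a.2⟩ ∈ Q) : F.LiftsMod Q f := by
  obtain ⟨k, hk, hkg⟩ := hg
  refine ⟨k.comp (Subgroup.inclusion (sup_le_sup_right hAB Q)), hk.restrict _, fun a => ?_⟩
  have := mul_mem (h a) (hkg ⟨a, hAB a.2⟩)
  simpa [mul_assoc, Subgroup.inclusion] using this

theorem LiftsMod.comp (hQ : F.StronglyClosed Q) {f : A →* P} {g : B →* P}
    (hf : F.LiftsMod Q f) (hg : F.LiftsMod Q g) (hB : ∀ a, f a ∈ B) :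
    F.LiftsMod Q (g.comp (f.codRestrict B hB)) := by
  have := hQ.normal
  obtain ⟨f', hf', hff⟩ := hf
  obtain ⟨g', hg', hgg⟩ := hg
  have hmem : ∀ x, f' x ∈ B ⊔ Q := by
    rintro ⟨x, hx⟩
    obtain ⟨a, ha, q, hq, rfl⟩ := Subgroup.mem_sup_of_normal_right.1 hx
    have h1 : f' ⟨a, (le_sup_left : A ≤ A ⊔ Q) ha⟩ ∈ B ⊔ Q := by
      have := mul_mem ((le_sup_left : B ≤ B ⊔ Q) (hB ⟨a, ha⟩))
        ((le_sup_right : Q ≤ B ⊔ Q) (hff ⟨a, ha⟩))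
      simpa using this
    have h2 : f' ⟨q, (le_sup_right : Q ≤ A ⊔ Q) hq⟩ ∈ B ⊔ Q :=
      (le_sup_right : Q ≤ B ⊔ Q) (hQ.apply_mem hf' hq)
    have := mul_mem h1 h2
    rwa [← map_mul] at this
  refine ⟨g'.comp (f'.codRestrict _ hmem), hg'.comp hf' hmem, fun a => ?_⟩
  set y : (B ⊔ Q : Subgroup P) := ⟨f a, (le_sup_left : B ≤ B ⊔ Q) (hB a)⟩ with hy
  set z : (B ⊔ Q : Subgroup P) := ⟨f' ⟨a, (le_sup_left : A ≤ A ⊔ Q) a.2⟩, hmem _⟩ with hz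
  change (g ⟨f a, hB a⟩)⁻¹ * g' z ∈ Q
  have h1 : (g ⟨f a, hB a⟩)⁻¹ * g' y ∈ Q := hgg ⟨f a, hB a⟩
  have h2 : g' (y⁻¹ * z) ∈ Q := hQ.apply_mem hg' (hff a)
  have := mul_mem h1 h2
  rwa [map_mul, map_inv, mul_assoc, mul_inv_cancel_left] at this

/-- A lift `f` of `e` maps `Q` injectively into the finite group `Q`, hence onto it. So the image of
`f` contains `BQ`, and `f⁻¹` restricted to `BQ` lifts `e⁻¹`. -/
theorem LiftsMod.symm [Finite P] (hQ : F.StronglyClosed Q) {e : A ≃* B}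
    (he : F.LiftsMod Q (B.subtype.comp e.toMonoidHom)) :
    F.LiftsMod Q (A.subtype.comp e.symm.toMonoidHom) := by
  have := hQ.normal
  obtain ⟨f, hf, hfe⟩ := he
  obtain ⟨φ, hφ, hφf⟩ := hf.exists_mulEquiv rfl
  have hQr : Q ≤ f.range := by
    have hQ' : (f.comp (Subgroup.inclusion le_sup_right)).range = Q := by
      refine Subgroup.eq_of_le_of_card_ge ?_ ?_
      · rintro _ ⟨q, rfl⟩
        exact hQ.apply_mem hf q.2
      · exact (Nat.card_congr (MonoidHom.ofInjective
          (hf.restrict (le_sup_right : Q ≤ A ⊔ Q)).injective).toEquiv).le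
    refine hQ'.ge.trans ?_
    rintro _ ⟨q, rfl⟩
    exact ⟨_, rfl⟩
  have hfe' : ∀ b : B, (b : P)⁻¹ * f ⟨e.symm b, (le_sup_left : A ≤ A ⊔ Q) (e.symm b).2⟩ ∈ Q := by
    intro b
    simpa using hfe (e.symm b)
  have hle : B ⊔ Q ≤ f.range := by
    refine sup_le (fun b hb => ?_) hQr
    have h1 : f ⟨e.symm ⟨b, hb⟩, (le_sup_left : A ≤ A ⊔ Q) (e.symm _).2⟩ ∈ f.range := ⟨_, rfl⟩
    have := mul_mem h1 (inv_mem (hQr (hfe' ⟨b, hb⟩)))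
    simpa using this
  have hφs : F.Mor ((A ⊔ Q).subtype.comp φ.symm.toMonoidHom) := mor_of_mulEquiv (F.symm_mem φ hφ)
  refine ⟨((A ⊔ Q).subtype.comp φ.symm.toMonoidHom).comp (Subgroup.inclusion hle),
    hφs.restrict hle, fun b => ?_⟩
  set x : (A ⊔ Q : Subgroup P) := ⟨e.symm b, (le_sup_left : A ≤ A ⊔ Q) (e.symm b).2⟩ with hx
  set b' : f.range := ⟨b, hle ((le_sup_left : B ≤ B ⊔ Q) b.2)⟩ with hb'
  have h1 := hQ.apply_mem hφs (a := (b'⁻¹ * φ x)⁻¹)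
    (inv_mem (by simpa [hφf] using hfe' b))
  have h2 : ((A ⊔ Q).subtype.comp φ.symm.toMonoidHom) (b'⁻¹ * φ x)⁻¹ =
      (x : P)⁻¹ * φ.symm b' := by
    simp
  rw [h2] at h1
  exact h1

/-- The automorphisms in `F` of a subgroup `E` that act trivially on `E` modulo a strongly closed
subgroup. -/
def autTrivialMod (F : FusionSystem P) (Q E : Subgroup P) : Subgroup (F.aut E) where
  carrier := {α | ∀ a : E, (α.1 a : P)⁻¹ * a ∈ Q}
  one_mem' := by simp
  mul_mem' := by
    intro α β hα hβ a
    have := mul_mem (hα (β.1 a)) (hβ a)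
    simpa [mul_assoc] using this
  inv_mem' := by
    intro α hα a
    have := inv_mem (hα (α.1⁻¹ a))
    simpa using this

theorem StronglyClosed.autTrivialMod_normal (hQ : F.StronglyClosed Q) (E : Subgroup P) :
    (F.autTrivialMod Q E).Normal := by
  refine ⟨fun α hα g a => ?_⟩
  have h1 := hQ.apply_mem (mor_of_mulEquiv g.2) (a := (α.1 (g.1⁻¹ a))⁻¹ * g.1⁻¹ a)
    (hα (g.1⁻¹ a))
  have h2 : (E.subtype.comp (MulEquiv.toMonoidHom g.1)) ((α.1 (g.1⁻¹ a))⁻¹ * g.1⁻¹ a) =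
      (((g * α * g⁻¹).1 a : E) : P)⁻¹ * a := by
    simp
  rwa [h2] at h1

theorem card_lt_card_inf_normalizer [Finite P] [Fact p.Prime] (hP : IsPGroup p P)
    (h : A < B) : Nat.card A < Nat.card (B ⊓ Subgroup.normalizer (A : Set P) : Subgroup P) := by
  have : Group.IsNilpotent P := hP.isNilpotent
  have hlt : A.subgroupOf B < ⊤ := by
    rw [lt_top_iff_ne_top, Ne, Subgroup.subgroupOf_eq_top]
    exact h.not_ge
  obtain ⟨g, hg, hgA⟩ := SetLike.exists_of_lt
    (Group.normalizerCondition_of_isNilpotent (G := B) _ hlt)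
  have hlt' : A < B ⊓ Subgroup.normalizer (A : Set P) := by
    refine lt_of_le_not_ge (le_inf h.le Subgroup.le_normalizer) fun hle => hgA (hle ?_)
    refine Subgroup.mem_inf.2 ⟨g.2, ?_⟩
    refine Subgroup.mem_normalizer_fintype fun x hx => ?_
    exact (Subgroup.mem_normalizer_iff.1 hg ⟨x, h.le hx⟩).1 hx
  exact Set.Finite.card_lt_card (Set.toFinite _) hlt'

/-- Elements of `Q` normalizing `E` induce automorphisms trivial modulo `Q`. So it suffices to
replace `α` by a congruent `β` that conjugates just those members of `Aut_P(E)` back into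
`Aut_P(E)`; such a `β` extends to `N_{EQ}(E)`, where `ih` applies. -/
theorem IsSaturated.liftsMod_aut [Finite P] [Fact p.Prime] (hP : IsPGroup p P)
    (hF : F.IsSaturated p) (hQ : F.StronglyClosed Q) {E : Subgroup P} (hE : F.FullyNormalized E)
    (ih : ∀ (B : Subgroup P) (f : B →* P), Nat.card E < Nat.card B → F.Mor f → F.LiftsMod Q f)
    {α : MulAut E} (hα : α ∈ F.aut E) :
    F.LiftsMod Q (E.subtype.comp (MulEquiv.toMonoidHom α)) := by
  by_cases hle : Q ≤ E
  · exact liftsMod_of_le (mor_of_mulEquiv hα) hle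
  have := hQ.normal
  have := hQ.autTrivialMod_normal E
  have : Finite (MulAut E) := Finite.of_injective (fun e : MulAut E => (e : E → E))
    DFunLike.coe_injective
  obtain ⟨S, hS⟩ := hF.fullyAutomized hP hE
  have hmemS : ∀ β : F.aut E, β ∈ S ↔ (β : MulAut E) ∈ autInner E := by
    intro β
    change β ∈ (S : Subgroup (F.aut E)) ↔ _
    rw [hS, Subgroup.mem_subgroupOf]
  obtain ⟨κ, hκ, hconj⟩ := S.exists_mul_conj_mem (F.autTrivialMod Q E) ⟨α, hα⟩
  set β : F.aut E := κ * ⟨α, hα⟩ with hβ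
  set N : Subgroup P := (E ⊔ Q) ⊓ Subgroup.normalizer (E : Set P) with hN
  have hEN : E ≤ N := le_inf le_sup_left Subgroup.le_normalizer
  have hcard : Nat.card E < Nat.card N := card_lt_card_inf_normalizer hP
    (lt_of_le_of_ne le_sup_left fun h => hle (h ▸ le_sup_right))
  obtain ⟨ψ, hψ, hψβ⟩ := hF.exists_extension (N := N) (e := β.1) β.2 hE hEN (by
    rintro x ⟨hx, hxE⟩
    refine ⟨hxE, ?_⟩
    obtain ⟨e, he, q, hq, rfl⟩ := Subgroup.mem_sup_of_normal_right.1 hx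
    have hqE : q ∈ Subgroup.normalizer (E : Set P) :=
      (Subgroup.mul_mem_cancel_left _ (Subgroup.le_normalizer he)).1 hxE
    set c : MulAut E := E.normalizerMonoidHom ⟨q, hqE⟩ with hc
    have hci : c ∈ autInner E := ⟨⟨q, hqE⟩, rfl⟩
    have hcval : ∀ a, (c a : P) = q * a * q⁻¹ := fun a => rfl
    have hcK : (⟨c, autInner_le_aut hci⟩ : F.aut E) ∈ F.autTrivialMod Q E := by
      intro a
      change (c a : P)⁻¹ * a ∈ Q
      have h1 := mul_mem hq (hQ.normal.conj_mem q⁻¹ (inv_mem hq) (a : P)⁻¹)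
      rw [hcval]
      convert h1 using 1
      group
    obtain ⟨y, hy, hyc⟩ := mem_autInner.1
      ((hmemS _).1 (hconj ⟨c, autInner_le_aut hci⟩ ((hmemS _).2 hci) hcK))
    -- Conjugation by `x = eq` is `c` followed by conjugation by `e`; `β` turns these into
    -- conjugation by `y` and by `β(e)`.
    refine ⟨β.1 ⟨e, he⟩ * y, mul_mem (Subgroup.le_normalizer (β.1 ⟨e, he⟩).2) hy,
      fun a a' haa => ?_⟩
    have h1 : a' = ⟨e, he⟩ * c a * ⟨e, he⟩⁻¹ := by
      refine Subtype.ext ?_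
      rw [haa]
      simp [hcval, mul_assoc]
    have h2 : (β.1 (c a) : P) = y * β.1 a * y⁻¹ := by
      simpa using hyc (β.1 a)
    rw [h1, map_mul, map_mul, map_inv]
    simp [h2, mul_assoc])
  refine (ih N ψ hcard hψ).restrict hEN fun a => ?_
  rw [hψβ]
  have := inv_mem (hκ (α a))
  simpa [hβ] using this

/-- Every morphism of a saturated fusion system is congruent modulo a strongly closed subgroup `Q`
to a morphism whose domain contains `Q`. -/
theorem IsSaturated.liftsMod [Finite P] [Fact p.Prime] (hP : IsPGroup p P)
    (hF : F.IsSaturated p) (hQ : F.StronglyClosed Q) {f : A →* P} (hf : F.Mor f) :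
    F.LiftsMod Q f := by
  induction hn : Nat.card P - Nat.card A using Nat.strong_induction_on generalizing A with
  | _ n ih =>
  subst hn
  by_cases htop : A = ⊤
  · exact liftsMod_of_le hf (htop ▸ le_top)
  have ih' : ∀ (B : Subgroup P) (g : B →* P), Nat.card A < Nat.card B → F.Mor g →
      F.LiftsMod Q g := by
    intro B g hB hg
    have := Subgroup.card_le_card_group B
    exact ih _ (by omega) hg rfl
  obtain ⟨B, hB⟩ : ∃ B, f.range = B := ⟨_, rfl⟩
  obtain ⟨φ, hφ, hφf⟩ := hf.exists_mulEquiv hB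
  obtain ⟨E, ε, hε, hE⟩ := exists_fullyNormalized F A
  have hcard : ∀ {C D : Subgroup P} (e : C ≃* D), Nat.card C = Nat.card D :=
    fun e => Nat.card_congr e.toEquiv
  -- Used for both `C = A` and `C = f(A)`: an isomorphism to `E` that extends to `N_P(C) > C` lifts
  -- by induction.
  have key : ∀ {C : Subgroup P} (e : C ≃* E), e.toMonoidHom ∈ F.Hom C E →
      ∃ e' : C ≃* E, e'.toMonoidHom ∈ F.Hom C E ∧
        F.LiftsMod Q (E.subtype.comp e'.toMonoidHom) := by
    intro C e he
    have hC : C ≠ ⊤ := by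
      rintro rfl
      refine htop (Subgroup.eq_top_of_card_eq A ?_)
      rw [hcard ε, ← hcard e, Subgroup.card_top]
    obtain ⟨e', ψ, he', hψ, hψe⟩ := hF.exists_extension_normalizer hP he hE
    refine ⟨e', he', (ih' _ ψ ?_ hψ).restrict Subgroup.le_normalizer fun a => ?_⟩
    · rw [hcard ε, ← hcard e]
      exact card_lt_card_normalizer hP hC
    · rw [hψe]
      simp
  obtain ⟨e₁, he₁, hl₁⟩ := key ε hε
  obtain ⟨e₂, he₂, hl₂⟩ := key (φ.symm.trans ε) (mulEquiv_trans_mem (F.symm_mem φ hφ) hε)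
  have hα : ((e₁.symm.trans φ).trans e₂ : MulAut E) ∈ F.aut E :=
    mulEquiv_trans_mem (mulEquiv_trans_mem (F.symm_mem e₁ he₁) hφ) he₂
  have hlα := hF.liftsMod_aut hP hQ hE (fun C g hC hg => ih' C g (hcard ε ▸ hC) hg) hα
  -- `f` factors as `e₁`, then the automorphism `e₂ ∘ φ ∘ e₁⁻¹` of `E`, then `e₂⁻¹`.
  have h := (hl₁.comp hQ hlα fun a => (e₁ a).2).comp hQ (hl₂.symm hQ)
    (fun a => Subtype.property _)
  convert h
  ext a
  have : φ a = e₂.symm (((e₁.symm.trans φ).trans e₂) (e₁ a)) := by simp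
  exact (hφf a).symm.trans (congrArg Subtype.val this)

/-! ### Products of strongly closed subgroups -/

/-- The join of two strongly closed subgroups is strongly closed. -/
theorem StronglyClosed.sup [Finite P] [Fact p.Prime] (hP : IsPGroup p P)
    (hF : F.IsSaturated p) {R : Subgroup P} (hQ : F.StronglyClosed Q) (hR : F.StronglyClosed R) :
    F.StronglyClosed (Q ⊔ R) := by
  have := hR.normal
  refine stronglyClosed_iff.2 fun {A} f hf a ha => ?_
  obtain ⟨g, hg, hgf⟩ := hF.liftsMod hP hQ hf
  obtain ⟨q, hq, r, hr, hqr⟩ := Subgroup.mem_sup_of_normal_right.1 ha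
  have hq' : q ∈ A ⊔ Q := (le_sup_right : Q ≤ A ⊔ Q) hq
  have ha' : (a : P) ∈ A ⊔ Q := (le_sup_left : A ≤ A ⊔ Q) a.2
  have hr' : r ∈ A ⊔ Q := (Subgroup.mul_mem_cancel_left _ hq').1 (hqr ▸ ha')
  have h1 : g ⟨a, ha'⟩ = g ⟨q, hq'⟩ * g ⟨r, hr'⟩ := by
    rw [← map_mul]
    exact congrArg g (Subtype.ext hqr.symm)
  have h2 : g ⟨a, ha'⟩ ∈ Q ⊔ R := by
    rw [h1]
    exact mul_mem ((le_sup_left : Q ≤ Q ⊔ R) (hQ.apply_mem hg hq))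
      ((le_sup_right : R ≤ Q ⊔ R) (hR.apply_mem hg hr))
  have := mul_mem h2 (inv_mem ((le_sup_left : Q ≤ Q ⊔ R) (hgf a)))
  simpa using this

end FusionSystem

theorem theoremD {p : ℕ} [Fact p.Prime] {P : Type u} [Group P] [Finite P] (hP : IsPGroup p P)
    (F : FusionSystem P) (hF : F.IsSaturated p) (Q R : Subgroup P)
    (hQ : F.StronglyClosed Q) (hR : F.StronglyClosed R) :
    ∃ T : Subgroup P, (T : Set P) = (Q : Set P) * (R : Set P) ∧ F.StronglyClosed T := by
  have := hR.normal
  exact ⟨Q ⊔ R, Subgroup.mul_normal Q R, hQ.sup hP hF hR⟩
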